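/- Let $X$ be a compact topological space with its Borel $\sigma$-algebra $\mathcal B$, and let $\mu$ be a finite regular nonnegative Borel measure on $X$ that is atomless, i.e. $\mu(\{x\})=0$ for every $x\in X$. Let $N,J$ be natural numbers and let $\bar\zeta=(\zeta_1,\dots,\zeta_J):X\to\mathbb R^J$ be continuous with $\zeta_j(x)\ge 0$ and $\sum_{j=1}^J\zeta_j(x)=1$ for all $x\in X$. Put $\bar\mu:=\bar\zeta\mu$, and let $\mathbb M_+(N,J)$ be the set of $N\times J$ matrices with nonnegative real entries. A weak subpartition of $(X,\mu)$ of order $N$ is a tuple $(\mu_1,\dots,\mu_N)$ of nonnegative Radon measures on $X$ with $\sum_{i=1}^N\mu_i\le\mu$; it is a weak partition if $\sum_{i=1}^N\mu_i=\mu$. Its capacity matrix is $\left(\int_X\zeta_j\,d\mu_i\right)_{i,j}$. Let $\mathbf\Delta_N(\bar\mu)$ (resp. $\underline{\mathbf\Delta}_N(\bar\mu)$) be the set of all $M\in\mathbb M_+(N,J)$ that are the capacity matrix of some weak partition (resp. weak subpartition). A strong subpartition of order $N$ is a tuple $(A_1,\dots,A_N)$ of Borel subsets of $X$ with $\mu(A_i\cap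 A_j)=0$ for $i\ne j$; it is a strong partition if moreover $\mu\left(\bigcup_{i=1}^N A_i\right)=\mu(X)$. Its capacity matrix is $\left(\int_{A_i}\zeta_j\,d\mu\right)_{i,j}$. Let $\mathbf\Delta^s_N(\bar\mu)$ (resp. $\underline{\mathbf\Delta}^s_N(\bar\mu)$) be the set of all $M\in\mathbb M_+(N,J)$ that are the capacity matrix of some strong partition (resp. strong subpartition). Then $$\mathbf\Delta^s_N(\bar\mu)=\mathbf\Delta_N(\bar\mu)\qquad\text{and}\qquad\underline{\mathbf\Delta}^s_N(\bar\mu)=\underline{\mathbf\Delta}_N(\bar\mu).$$ In particular, every matrix that is the capacity matrix of a weak partition (resp. subpartition) is the capacity matrix of a strong partition (resp. subpartition). -/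

import Mathlib

open MeasureTheory

/-- The set `𝕄₊(N, J)` of `N × J` matrices with nonnegative real entries. -/
def nonnegMatrices (N J : ℕ) : Set (Matrix (Fin N) (Fin J) ℝ) :=
  {M | ∀ i j, 0 ≤ M i j}

/-- A weak subpartition of `(X, μ)` of order `N`: Radon measures `ν₁, …, ν_N` with `∑ ν_i ≤ μ`.
(On a compact space a Radon measure is a regular Borel measure.) -/
def IsWeakSubpartition {X : Type*} [TopologicalSpace X] [MeasurableSpace X]
    (μ : Measure X) {N : ℕ} (ν : Fin N → Measure X) : Prop :=
  (∀ i, (ν i).Regular) ∧ ∑ i, ν i ≤ μ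

/-- A weak partition of `(X, μ)` of order `N`: Radon measures `ν₁, …, ν_N` with `∑ ν_i = μ`. -/
def IsWeakPartition {X : Type*} [TopologicalSpace X] [MeasurableSpace X]
    (μ : Measure X) {N : ℕ} (ν : Fin N → Measure X) : Prop :=
  (∀ i, (ν i).Regular) ∧ ∑ i, ν i = μ

/-- A strong subpartition: measurable sets `A₁, …, A_N` that are essentially disjoint. -/
def IsStrongSubpartition {X : Type*} [MeasurableSpace X]
    (μ : Measure X) {N : ℕ} (A : Fin N → Set X) : Prop :=
  (∀ i, MeasurableSet (A i)) ∧ ∀ i j, i ≠ j → μ (A i ∩ A j) = 0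

/-- A strong partition: a strong subpartition whose union has full measure. -/
def IsStrongPartition {X : Type*} [MeasurableSpace X]
    (μ : Measure X) {N : ℕ} (A : Fin N → Set X) : Prop :=
  IsStrongSubpartition μ A ∧ μ (⋃ i, A i) = μ Set.univ

/-- The capacity matrix `(∫ ζ_j dν_i)_{i,j}` of a tuple of measures. -/
noncomputable def weakCapacityMatrix {X : Type*} [MeasurableSpace X] {N J : ℕ}
    (ζ : X → Fin J → ℝ) (ν : Fin N → Measure X) : Matrix (Fin N) (Fin J) ℝ :=
  Matrix.of fun i j => ∫ x, ζ x j ∂(ν i)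

/-- The capacity matrix `(∫_{A_i} ζ_j dμ)_{i,j}` of a tuple of sets. -/
noncomputable def strongCapacityMatrix {X : Type*} [MeasurableSpace X] {N J : ℕ}
    (μ : Measure X) (ζ : X → Fin J → ℝ) (A : Fin N → Set X) : Matrix (Fin N) (Fin J) ℝ :=
  Matrix.of fun i j => ∫ x in A i, ζ x j ∂μ

/-- The feasibility set `Δ_N`: capacity matrices of weak partitions. -/
def weakFeasible {X : Type*} [TopologicalSpace X] [MeasurableSpace X]
    (μ : Measure X) (N : ℕ) {J : ℕ} (ζ : X → Fin J → ℝ) : Set (Matrix (Fin N) (Fin J) ℝ) :=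
  {M | M ∈ nonnegMatrices N J ∧
    ∃ ν : Fin N → Measure X, IsWeakPartition μ ν ∧ weakCapacityMatrix ζ ν = M}

/-- The feasibility set `Δ̲_N`: capacity matrices of weak subpartitions. -/
def weakSubFeasible {X : Type*} [TopologicalSpace X] [MeasurableSpace X]
    (μ : Measure X) (N : ℕ) {J : ℕ} (ζ : X → Fin J → ℝ) : Set (Matrix (Fin N) (Fin J) ℝ) :=
  {M | M ∈ nonnegMatrices N J ∧
    ∃ ν : Fin N → Measure X, IsWeakSubpartition μ ν ∧ weakCapacityMatrix ζ ν = M}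

/-- The strong feasibility set `Δˢ_N`: capacity matrices of strong partitions. -/
def strongFeasible {X : Type*} [MeasurableSpace X]
    (μ : Measure X) (N : ℕ) {J : ℕ} (ζ : X → Fin J → ℝ) : Set (Matrix (Fin N) (Fin J) ℝ) :=
  {M | M ∈ nonnegMatrices N J ∧
    ∃ A : Fin N → Set X, IsStrongPartition μ A ∧ strongCapacityMatrix μ ζ A = M}

/-- The strong feasibility set `Δ̲ˢ_N`: capacity matrices of strong subpartitions. -/
def strongSubFeasible {X : Type*} [MeasurableSpace X]
    (μ : Measure X) (N : ℕ) {J : ℕ} (ζ : X → Fin J → ℝ) : Set (Matrix (Fin N) (Fin J) ℝ) :=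
  {M | M ∈ nonnegMatrices N J ∧
    ∃ A : Fin N → Set X, IsStrongSubpartition μ A ∧ strongCapacityMatrix μ ζ A = M}

/-!
A strong (sub)partition yields a weak one with the same capacity matrix by restricting `μ` to its
sets; the restrictions are regular because `μ` is finite and regular
(`regular_restrict_of_isFiniteMeasure`).

The converse is the Dvoretzky–Wald–Wolfowitz theorem (`exists_partition_setIntegral_eq`). A weak
partition `ν` has densities `0 ≤ g i ≤ 1` with `∑ i, g i = 1`. The tuples of such densities with a
prescribed capacity matrix form a convex set, which is compact for the weak topology of `L²(μ)`
(`isCompact_fractionalPartitions`), so by the Krein–Milman lemma it has an extreme point. At an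
extreme point no two densities are simultaneously positive on a set of positive measure
(`ae_mul_eq_zero_of_mem_extremePoints`): since `μ` is atomless, the bounded functions on such a set
form an infinite-dimensional space, so one of them, nonzero and small, is orthogonal to all the
`ζ_j`, and moving this mass between the two densities in either direction would contradict
extremality. Hence the extreme densities are indicators of sets, which form the strong partition.
For a weak subpartition, the unused mass `μ - ∑ i, ν i` is added as one more member of the tuple
and its set is then discarded.

The splitting property of `μ` used here follows from outer regularity and compactness
(`exists_measurable_subset_pos_lt`), and no separation axiom on the space is needed.
-/

/-! ### Atomless measures -/

section Atomless

variable {X : Type*} [MeasurableSpace X] {μ : Measure X}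

/-- A measure without point masses has no atoms at all: outer regularity gives every point an open
neighbourhood of measure less than `μ s`, and finitely many of these cover the space. -/
theorem exists_measurable_subset_pos_lt [TopologicalSpace X] [CompactSpace X] [BorelSpace X]
    [μ.OuterRegular] [NullSingletonClass μ] {s : Set X} (hs : MeasurableSet s) (hμs : 0 < μ s) :
    ∃ t ⊆ s, MeasurableSet t ∧ 0 < μ t ∧ μ t < μ s := by
  have hU : ∀ x : X, ∃ U ⊇ {x}, IsOpen U ∧ μ U < μ s := fun x =>
    Set.exists_isOpen_lt_of_lt {x} (μ s) (by simpa [measure_singleton] using hμs)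
  choose U hxU hUo hUμ using hU
  obtain ⟨T, hT⟩ := isCompact_univ.elim_finite_subcover U hUo
    fun x _ => Set.mem_iUnion.2 ⟨x, hxU x rfl⟩
  by_contra! H
  have hnull : ∀ x ∈ T, μ (s ∩ U x) = 0 := by
    intro x _
    by_contra h
    exact ((H _ Set.inter_subset_left (hs.inter (hUo x).measurableSet)
      (pos_iff_ne_zero.2 h)).trans (measure_mono Set.inter_subset_right)).not_gt (hUμ x)
  refine hμs.ne' (measure_mono_null (fun y hy => ?_)
    ((measure_biUnion_null_iff T.countable_toSet).2 hnull))
  obtain ⟨x, hx, hyx⟩ := Set.mem_iUnion₂.1 (hT (Set.mem_univ y))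
  exact Set.mem_iUnion₂.2 ⟨x, hx, hy, hyx⟩

theorem exists_pairwise_disjoint_measure_pos
    (hμ : ∀ s, MeasurableSet s → 0 < μ s → ∃ t ⊆ s, MeasurableSet t ∧ 0 < μ t ∧ μ t < μ s)
    (n : ℕ) {s : Set X} (hs : MeasurableSet s) (hμs : 0 < μ s) :
    ∃ D : Fin n → Set X, (∀ k, MeasurableSet (D k)) ∧ (∀ k, D k ⊆ s) ∧ (∀ k, 0 < μ (D k)) ∧
      Pairwise fun k l => Disjoint (D k) (D l) := by
  induction n generalizing s with
  | zero => exact ⟨fun _ => ∅, fun k => k.elim0, fun k => k.elim0, fun k => k.elim0,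
      fun k => k.elim0⟩
  | succ n ih =>
    obtain ⟨t, hts, ht, ht0, htlt⟩ := hμ s hs hμs
    have hpos : 0 < μ (s \ t) := (tsub_pos_of_lt htlt).trans_le le_measure_sdiff
    obtain ⟨D, hD, hDs, hDpos, hdisj⟩ := ih (hs.diff ht) hpos
    have htD : ∀ k, Disjoint t (D k) := fun k => Set.disjoint_sdiff_right.mono_right (hDs k)
    refine ⟨Fin.cons t D, Fin.cases ht hD, Fin.cases hts fun k => (hDs k).trans Set.sdiff_subset,
      Fin.cases ht0 hDpos, ?_⟩
    intro k l
    refine Fin.cases ?_ (fun k => ?_) k <;> refine Fin.cases ?_ (fun l => ?_) l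
    · exact fun h => (h rfl).elim
    · exact fun _ => htD l
    · exact fun _ => (htD k).symm
    · exact fun h => hdisj fun hkl => h (congrArg Fin.succ hkl)

/-- On a set of positive measure of an atomless measure the bounded functions form an
infinite-dimensional space, so a nonzero one, as small as desired, is orthogonal to finitely many
given functions. -/
theorem exists_Lp_ne_zero_inner_eq_zero [IsFiniteMeasure μ] {κ : Type*} [Finite κ]
    (hμ : ∀ s, MeasurableSet s → 0 < μ s → ∃ t ⊆ s, MeasurableSet t ∧ 0 < μ t ∧ μ t < μ s)
    (F : κ → Lp ℝ 2 μ) {s : Set X} (hs : MeasurableSet s) (hμs : 0 < μ s) {ε : ℝ} (hε : 0 < ε) :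
    ∃ h : Lp ℝ 2 μ, h ≠ 0 ∧ (∀ k, inner ℝ h (F k) = 0) ∧
      ∀ᵐ x ∂μ, |h x| ≤ s.indicator (fun _ => ε) x := by
  have := Fintype.ofFinite κ
  obtain ⟨D, hD, hDs, hDpos, hdisj⟩ :=
    exists_pairwise_disjoint_measure_pos hμ (Fintype.card κ + 1) hs hμs
  let e (k : Fin (Fintype.card κ + 1)) : Lp ℝ 2 μ := indicatorConstLp 2 (hD k) (measure_ne_top μ _) 1
  let L : (Fin (Fintype.card κ + 1) → ℝ) →ₗ[ℝ] κ → ℝ :=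
    LinearMap.pi fun j => (innerₗ (Lp ℝ 2 μ) (F j)) ∘ₗ Fintype.linearCombination ℝ e
  obtain ⟨c, hc, hc0⟩ := Submodule.exists_mem_ne_zero_of_ne_bot
    (LinearMap.ker_ne_bot_of_finrank_lt (f := L) (by simp))
  obtain ⟨k, hk⟩ := Function.ne_iff.1 hc0
  have hcn : 0 < ‖c‖ := norm_pos_iff.2 hc0
  have hcoe : ∀ᵐ x ∂μ, (Fintype.linearCombination ℝ e c) x
      = ∑ l, c l * (D l).indicator (fun _ => (1 : ℝ)) x := by
    have h1 : ∀ᵐ x ∂μ, ∀ l, (c l • e l) x = c l * (D l).indicator (fun _ => (1 : ℝ)) x := by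
      refine ae_all_iff.2 fun l => ?_
      filter_upwards [Lp.coeFn_smul (c l) (e l), indicatorConstLp_coeFn (p := 2) (hs := hD l)
        (hμs := measure_ne_top μ (D l)) (c := (1 : ℝ))] with x hx hx'
      rw [hx, Pi.smul_apply, hx', smul_eq_mul]
    filter_upwards [Lp.coeFn_fun_finsetSum Finset.univ fun l => c l • e l, h1] with x hx hx'
    rw [Fintype.linearCombination_apply, hx]
    exact Finset.sum_congr rfl fun l _ => hx' l
  -- at most one of the disjoint sets contains a given point
  have hon : ∀ l x, x ∈ D l →
      ∑ m, c m * (D m).indicator (fun _ => (1 : ℝ)) x = c l := by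
    intro l x hx
    rw [Finset.sum_eq_single l]
    · simp [hx]
    · intro m _ hml
      rw [Set.indicator_of_notMem (Set.disjoint_left.1 (hdisj hml.symm) hx), mul_zero]
    · simp
  refine ⟨(ε / ‖c‖) • Fintype.linearCombination ℝ e c, ?_, ?_, ?_⟩
  · refine smul_ne_zero (div_pos hε hcn).ne' fun h0 => (hDpos k).ne' ?_
    refine measure_eq_zero_iff_ae_notMem.2 ?_
    have h0' := Lp.coeFn_zero ℝ 2 μ
    rw [← h0] at h0'
    filter_upwards [hcoe, h0'] with x hx hx' hxk
    rw [hx, hon k x hxk] at hx'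
    exact hk hx'
  · intro j
    have : L c j = 0 := by rw [LinearMap.mem_ker.1 hc]; rfl
    rw [inner_smul_left, real_inner_comm]
    simp only [L, LinearMap.pi_apply, LinearMap.comp_apply, innerₗ_apply_apply] at this
    rw [this, mul_zero]
  · filter_upwards [hcoe, Lp.coeFn_smul (ε / ‖c‖) (Fintype.linearCombination ℝ e c)] with x hx hx'
    rw [hx', Pi.smul_apply, hx, smul_eq_mul, abs_mul, abs_of_pos (div_pos hε hcn)]
    by_cases hxD : ∃ l, x ∈ D l
    · obtain ⟨l, hl⟩ := hxD
      rw [hon l x hl, Set.indicator_of_mem (hDs l hl)]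
      calc ε / ‖c‖ * |c l| ≤ ε / ‖c‖ * ‖c‖ := by gcongr; exact norm_le_pi_norm c l
        _ = ε := div_mul_cancel₀ _ hcn.ne'
    · push Not at hxD
      rw [Finset.sum_eq_zero fun l _ => by rw [Set.indicator_of_notMem (hxD l), mul_zero]]
      simpa using Set.indicator_nonneg (fun _ _ => hε.le) x

end Atomless

/-! ### Fractional partitions and their extreme points -/

section Fractional

variable {X : Type*} [MeasurableSpace X] (μ : Measure X) {ι κ : Type*} [Fintype ι]

/-- The functional `h ↦ ∫ g h dμ` on `L²(μ)`, as an element of the weak dual. -/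
noncomputable def weakDualOfLp : Lp ℝ 2 μ ≃ₗ[ℝ] WeakDual ℝ (Lp ℝ 2 μ) :=
  (InnerProductSpace.toDual ℝ (Lp ℝ 2 μ)).toLinearEquiv ≪≫ₗ StrongDual.toWeakDual

theorem weakDualOfLp_apply (g h : Lp ℝ 2 μ) : weakDualOfLp μ g h = inner ℝ g h := rfl

variable [IsFiniteMeasure μ]

theorem weakDualOfLp_indicator (g : Lp ℝ 2 μ) {s : Set X} (hs : MeasurableSet s) :
    weakDualOfLp μ g (indicatorConstLp 2 hs (measure_ne_top μ s) 1) = ∫ x in s, g x ∂μ := by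
  rw [weakDualOfLp_apply, real_inner_comm, L2.inner_indicatorConstLp_one]

/-- The fractional partitions of `μ` with moment matrix `M`: the tuples of densities `g i ≥ 0` with
`∑ i, g i = 1` almost everywhere and `∫ g i * F k ∂μ = M i k`. Each density is encoded as a
functional on `L²(μ)`, and the constraints are tested on indicators of measurable sets, so that
they are visibly closed in the weak-* topology. See
`weakDualOfLp_mem_fractionalPartitions_iff` for the description by densities. -/
def fractionalPartitions (F : κ → Lp ℝ 2 μ) (M : ι → κ → ℝ) :
    Set (ι → WeakDual ℝ (Lp ℝ 2 μ)) :=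
  {φ | (∀ i (s : Set X) (hs : MeasurableSet s),
        0 ≤ φ i (indicatorConstLp 2 hs (measure_ne_top μ s) 1)) ∧
      (∀ (s : Set X) (hs : MeasurableSet s),
        ∑ i, φ i (indicatorConstLp 2 hs (measure_ne_top μ s) 1) = μ.real s) ∧
      ∀ i k, φ i (F k) = M i k}

variable {μ} {F : κ → Lp ℝ 2 μ} {M : ι → κ → ℝ}

theorem weakDualOfLp_mem_fractionalPartitions_iff {g : ι → Lp ℝ 2 μ} :
    (fun i => weakDualOfLp μ (g i)) ∈ fractionalPartitions μ F M ↔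
      (∀ᵐ x ∂μ, ∀ i, 0 ≤ g i x) ∧ (∀ᵐ x ∂μ, ∑ i, g i x = 1) ∧
        ∀ i k, inner ℝ (g i) (F k) = M i k := by
  have hint : ∀ i, Integrable (g i) μ := fun i => (Lp.memLp (g i)).integrable (by norm_num)
  simp only [fractionalPartitions, Set.mem_ofPred_eq, weakDualOfLp_indicator]
  refine and_congr ?_ (and_congr ?_ Iff.rfl)
  · rw [ae_all_iff]
    exact forall_congr' fun i => ⟨fun h => ae_nonneg_of_forall_setIntegral_nonneg (hint i)
      fun s hs _ => h s hs, fun h s _ => integral_nonneg_of_ae (ae_restrict_of_ae h)⟩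
  · have hsum : ∀ s, ∑ i, ∫ x in s, g i x ∂μ = ∫ x in s, ∑ i, g i x ∂μ := fun s =>
      (integral_finsetSum _ fun i _ => (hint i).integrableOn).symm
    have hone : ∀ s, μ.real s = ∫ _ in s, (1 : ℝ) ∂μ := fun s => by simp
    simp only [hsum, hone]
    exact ⟨fun h => Integrable.ae_eq_of_forall_setIntegral_eq _ _
      (integrable_finsetSum _ fun i _ => hint i) (integrable_const 1) fun s hs _ => h s hs,
      fun h s _ => integral_congr_ae (ae_restrict_of_ae h)⟩

theorem isClosed_fractionalPartitions : IsClosed (fractionalPartitions μ F M) := by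
  have hcont : ∀ i (h : Lp ℝ 2 μ), Continuous fun φ : ι → WeakDual ℝ (Lp ℝ 2 μ) => φ i h :=
    fun i h => (WeakDual.eval_continuous h).comp (continuous_apply i)
  simp only [fractionalPartitions, Set.ofPred_and, Set.ofPred_forall]
  refine .inter ?_ (.inter ?_ ?_)
  · exact isClosed_iInter fun i => isClosed_iInter fun s => isClosed_iInter fun hs =>
      isClosed_le continuous_const (hcont i _)
  · exact isClosed_iInter fun s => isClosed_iInter fun hs =>
      isClosed_eq (continuous_finsetSum _ fun i _ => hcont i _) continuous_const
  · exact isClosed_iInter fun i => isClosed_iInter fun k =>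
      isClosed_eq (hcont i _) continuous_const

/-- The densities take values in `[0, 1]`, so they are bounded in `L²(μ)`, and the Banach–Alaoglu
theorem applies. -/
theorem isCompact_fractionalPartitions : IsCompact (fractionalPartitions μ F M) := by
  refine IsCompact.of_isClosed_subset (isCompact_univ_pi fun _ : ι =>
    WeakDual.isCompact_closedBall (𝕜 := ℝ) (E := Lp ℝ 2 μ) 0
      ((measureUnivNNReal μ : ℝ) ^ (2 : ENNReal).toReal⁻¹ * 1))
    isClosed_fractionalPartitions fun φ hφ i _ => ?_
  obtain ⟨g, rfl⟩ : ∃ g : ι → Lp ℝ 2 μ, (fun i => weakDualOfLp μ (g i)) = φ :=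
    ⟨fun i => (weakDualOfLp μ).symm (φ i), by simp⟩
  obtain ⟨hg0, hg1, -⟩ := weakDualOfLp_mem_fractionalPartitions_iff.1 hφ
  refine mem_closedBall_zero_iff.2
    ((LinearIsometryEquiv.norm_map (InnerProductSpace.toDual ℝ (Lp ℝ 2 μ)) (g i)).trans_le ?_)
  refine Lp.norm_le_of_ae_bound zero_le_one ?_
  filter_upwards [hg0, hg1] with x hx0 hx1
  rw [Real.norm_of_nonneg (hx0 i), ← hx1]
  exact Finset.single_le_sum (fun j _ => hx0 j) (Finset.mem_univ i)

/-- The densities of an extreme fractional partition have essentially disjoint supports. -/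
theorem ae_mul_eq_zero_of_mem_extremePoints [Finite κ]
    (hμ : ∀ s, MeasurableSet s → 0 < μ s → ∃ t ⊆ s, MeasurableSet t ∧ 0 < μ t ∧ μ t < μ s)
    {g : ι → Lp ℝ 2 μ}
    (hg : (fun i => weakDualOfLp μ (g i)) ∈ (fractionalPartitions μ F M).extremePoints ℝ)
    {i j : ι} (hij : i ≠ j) : ∀ᵐ x ∂μ, g i x = 0 ∨ g j x = 0 := by
  classical
  obtain ⟨hmem, hext⟩ := mem_extremePoints.1 hg
  obtain ⟨hg0, hg1, hgM⟩ := weakDualOfLp_mem_fractionalPartitions_iff.1 hmem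
  have hmeas : ∀ i, Measurable (g i) := fun i => (Lp.stronglyMeasurable (g i)).measurable
  by_contra hne
  -- both densities exceed some `ε > 0` on a set of positive measure
  obtain ⟨n, hn⟩ : ∃ n : ℕ, 0 < μ {x | 1 / ((n : ℝ) + 1) ≤ g i x ∧ 1 / ((n : ℝ) + 1) ≤ g j x} := by
    by_contra! H
    refine hne ?_
    have H' : ∀ᵐ x ∂μ, ∀ n : ℕ, ¬ (1 / ((n : ℝ) + 1) ≤ g i x ∧ 1 / ((n : ℝ) + 1) ≤ g j x) :=
      ae_all_iff.2 fun n => measure_eq_zero_iff_ae_notMem.1 (le_antisymm (H n) zero_le)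
    filter_upwards [H', hg0] with x hx hx0
    by_contra! hx'
    obtain ⟨n, hn⟩ := exists_nat_one_div_lt
      (lt_min ((hx0 i).lt_of_ne' hx'.1) ((hx0 j).lt_of_ne' hx'.2))
    exact hx n ⟨(hn.trans_le (min_le_left _ _)).le, (hn.trans_le (min_le_right _ _)).le⟩
  set s := {x | 1 / ((n : ℝ) + 1) ≤ g i x ∧ 1 / ((n : ℝ) + 1) ≤ g j x}
  have hs : MeasurableSet s := (measurableSet_le measurable_const (hmeas i)).inter
    (measurableSet_le measurable_const (hmeas j))
  obtain ⟨h, hh0, hhF, hhs⟩ := exists_Lp_ne_zero_inner_eq_zero hμ F hs hn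
    (ε := 1 / ((n : ℝ) + 1)) Nat.one_div_pos_of_nat
  -- moving the mass `h` from `j` to `i`, or back, preserves the constraints
  have key : ∀ h : Lp ℝ 2 μ, (∀ k, inner ℝ h (F k) = 0) →
      (∀ᵐ x ∂μ, |h x| ≤ s.indicator (fun _ => 1 / ((n : ℝ) + 1)) x) →
      (fun l => weakDualOfLp μ (g l + (Pi.single i h - Pi.single j h : ι → Lp ℝ 2 μ) l)) ∈
        fractionalPartitions μ F M := by
    intro h hhF hhs
    -- the change of the `l`-th density at a point where `h` takes the value `t`
    let d : ι → ℝ → ℝ := fun l t => (Pi.single i t - Pi.single j t : ι → ℝ) l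
    have hcoe : ∀ᵐ x ∂μ, ∀ l,
        (g l + (Pi.single i h - Pi.single j h : ι → Lp ℝ 2 μ) l) x = g l x + d l (h x) := by
      refine ae_all_iff.2 fun l => ?_
      filter_upwards [Lp.coeFn_add (g l) ((Pi.single i h - Pi.single j h : ι → Lp ℝ 2 μ) l),
        Lp.coeFn_neg h, Lp.coeFn_zero ℝ 2 μ] with x hx hneg hzero
      rw [hx, Pi.add_apply]
      congr 1
      by_cases hi : l = i
      · subst hi
        simp [d, hij]
      · by_cases hj : l = j
        · subst hj
          rw [show (Pi.single i h - Pi.single l h : ι → Lp ℝ 2 μ) l = -h by simp [hi], hneg]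
          simp [d, hi]
        · rw [show (Pi.single i h - Pi.single j h : ι → Lp ℝ 2 μ) l = 0 by simp [hi, hj], hzero]
          simp [d, hi, hj]
    refine weakDualOfLp_mem_fractionalPartitions_iff.2 ⟨?_, ?_, fun l k => ?_⟩
    · filter_upwards [hcoe, hg0, hhs] with x hx hx0 hxs l
      rw [hx l]
      by_cases hxmem : x ∈ s
      · rw [Set.indicator_of_mem hxmem, abs_le] at hxs
        obtain ⟨hi', hj'⟩ := hxmem
        by_cases hi : l = i
        · subst hi
          simp only [d, Pi.sub_apply, Pi.single_eq_same, Pi.single_eq_of_ne hij]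
          linarith
        · by_cases hj : l = j
          · subst hj
            simp only [d, Pi.sub_apply, Pi.single_eq_same, Pi.single_eq_of_ne hi]
            linarith
          · simpa [d, hi, hj] using hx0 l
      · rw [Set.indicator_of_notMem hxmem] at hxs
        have : h x = 0 := abs_eq_zero.1 (le_antisymm hxs (abs_nonneg _))
        simpa [d, this] using hx0 l
    · filter_upwards [hcoe, hg1] with x hx hx1
      rw [Finset.sum_congr rfl fun l _ => hx l, Finset.sum_add_distrib, hx1]
      simp [d]
    · rw [inner_add_left, hgM, Pi.sub_apply, inner_sub_left]
      have : ∀ m, inner ℝ ((Pi.single m h : ι → Lp ℝ 2 μ) l) (F k) = 0 := by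
        intro m
        by_cases hm : l = m
        · subst hm
          simpa using hhF k
        · simp [hm]
      simp [this]
  have h1 := key h hhF hhs
  have h2 := key (-h) (fun k => by rw [inner_neg_left, hhF, neg_zero]) (by
    filter_upwards [hhs, Lp.coeFn_neg h] with x hx hx'
    rwa [hx', Pi.neg_apply, abs_neg])
  have h3 := (hext _ h1 _ h2 ⟨1 / 2, 1 / 2, by norm_num, by norm_num, by norm_num, by
    funext l
    simp only [Pi.add_apply, Pi.smul_apply, Pi.sub_apply, map_add, map_sub, Pi.single_neg,
      Pi.neg_apply, map_neg]
    module⟩).1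
  have h4 := (weakDualOfLp μ).injective (congrFun h3 i)
  simp only [Pi.sub_apply, Pi.single_eq_same, Pi.single_eq_of_ne hij, sub_zero,
    add_eq_left] at h4
  exact hh0 h4

/-- **Dvoretzky–Wald–Wolfowitz theorem**: for an atomless finite measure `μ`, a decomposition of `μ`
into a sum of measures can be replaced by a partition into measurable sets without changing the
integrals of finitely many square-integrable functions. -/
theorem exists_partition_setIntegral_eq [Finite κ]
    (hμ : ∀ s, MeasurableSet s → 0 < μ s → ∃ t ⊆ s, MeasurableSet t ∧ 0 < μ t ∧ μ t < μ s)
    {f : κ → X → ℝ} (hf : ∀ k, MemLp (f k) 2 μ) {ν : ι → Measure X} (hν : ∑ i, ν i = μ) :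
    ∃ A : ι → Set X, (∀ i, MeasurableSet (A i)) ∧ (∀ i j, i ≠ j → μ (A i ∩ A j) = 0) ∧
      μ (⋃ i, A i) = μ Set.univ ∧ ∀ i k, ∫ x in A i, f k x ∂μ = ∫ x, f k x ∂ν i := by
  classical
  have hle : ∀ i, ν i ≤ μ := fun i => by
    rw [← hν]
    exact Finset.single_le_sum (f := ν) (fun _ _ => Measure.zero_le _) (Finset.mem_univ i)
  have hfin : ∀ i, IsFiniteMeasure (ν i) := fun i => isFiniteMeasure_of_le μ (hle i)
  have hac : ∀ i, ν i ≪ μ := fun i => (hle i).absolutelyContinuous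
  let F (k : κ) : Lp ℝ 2 μ := (hf k).toLp (f k)
  have hr : ∀ i, MemLp (fun x => ((ν i).rnDeriv μ x).toReal) 2 μ := fun i =>
    MemLp.of_bound ((ν i).measurable_rnDeriv μ).ennreal_toReal.aestronglyMeasurable 1 (by
      filter_upwards [Measure.rnDeriv_le_one_of_le (hle i)] with x hx
      rw [Real.norm_of_nonneg ENNReal.toReal_nonneg]
      exact ENNReal.toReal_le_of_le_ofReal zero_le_one (by simpa using hx))
  have hinner : ∀ (g : Lp ℝ 2 μ) k, inner ℝ g (F k) = ∫ x, g x * f k x ∂μ := by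
    intro g k
    rw [L2.inner_def]
    refine integral_congr_ae ?_
    filter_upwards [(hf k).coeFn_toLp] with x hx
    rw [hx, real_inner_eq_re_inner, RCLike.inner_apply]
    simp [mul_comm]
  -- the Radon–Nikodym densities of `ν` form a fractional partition
  have hne : (fractionalPartitions μ F fun i k => ∫ x, f k x ∂ν i).Nonempty := by
    refine ⟨fun i => weakDualOfLp μ ((hr i).toLp _), ?_, ?_, ?_⟩
    · intro i s hs
      rw [weakDualOfLp_indicator, integral_congr_ae (ae_restrict_of_ae (hr i).coeFn_toLp)]
      exact integral_nonneg fun _ => ENNReal.toReal_nonneg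
    · intro s hs
      have : ∀ i, ∫ x in s, ((hr i).toLp _ : X → ℝ) x ∂μ = (ν i).real s := fun i => by
        rw [integral_congr_ae (ae_restrict_of_ae (hr i).coeFn_toLp),
          Measure.setIntegral_toReal_rnDeriv (hac i)]
      simp only [weakDualOfLp_indicator, this, Measure.real]
      rw [← ENNReal.toReal_sum fun i _ => measure_ne_top _ _, ← Measure.finsetSum_apply, hν]
    · intro i k
      rw [weakDualOfLp_apply, hinner]
      refine Eq.trans ?_ (integral_rnDeriv_smul (hac i))
      refine integral_congr_ae ?_
      filter_upwards [(hr i).coeFn_toLp] with x hx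
      rw [hx, smul_eq_mul]
  have : LocallyConvexSpace ℝ (WeakDual ℝ (Lp ℝ 2 μ)) := WeakBilin.locallyConvexSpace
  obtain ⟨φ, hφ⟩ := isCompact_fractionalPartitions.extremePoints_nonempty hne
  obtain ⟨g, rfl⟩ : ∃ g : ι → Lp ℝ 2 μ, (fun i => weakDualOfLp μ (g i)) = φ :=
    ⟨fun i => (weakDualOfLp μ).symm (φ i), by simp⟩
  obtain ⟨-, hg1, hgM⟩ := weakDualOfLp_mem_fractionalPartitions_iff.1 (extremePoints_subset hφ)
  have hmul : ∀ᵐ x ∂μ, ∀ i j, i ≠ j → g i x = 0 ∨ g j x = 0 :=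
    ae_all_iff.2 fun i => ae_all_iff.2 fun j => by
      by_cases hij : i = j
      · exact .of_forall fun _ h => (h hij).elim
      · filter_upwards [ae_mul_eq_zero_of_mem_extremePoints hμ hφ hij] with x hx _ using hx
  have hA : ∀ i, MeasurableSet {x | g i x ≠ 0} := fun i =>
    (Lp.stronglyMeasurable (g i)).measurable (measurableSet_singleton 0).compl
  refine ⟨fun i => {x | g i x ≠ 0}, hA, fun i j hij => ?_, ?_, fun i k => ?_⟩
  · refine measure_eq_zero_iff_ae_notMem.2 ?_
    filter_upwards [hmul] with x hx hxA
    exact (hx i j hij).elim hxA.1 hxA.2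
  · refine measure_congr (Filter.eventuallyEq_univ.2 ?_)
    filter_upwards [hg1] with x hx
    by_contra hxA
    simp only [Set.mem_iUnion, Set.mem_ofPred_eq, not_exists, not_not] at hxA
    simp [hxA] at hx
  · rw [← hgM i k, hinner, ← integral_indicator (hA i)]
    refine integral_congr_ae ?_
    filter_upwards [hg1, hmul] with x hx1 hxm
    by_cases hx0 : g i x = 0
    · simp [hx0]
    · have : g i x = 1 := by
        rw [← hx1, Finset.sum_eq_single i (fun j _ hji => (hxm i j hji.symm).resolve_left hx0)
          (by simp)]
      simp [this]

end Fractional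

/-! ### Restrictions of regular measures -/

section Regular

variable {X : Type*} [TopologicalSpace X] [MeasurableSpace X] [BorelSpace X] {μ : Measure X}

/-- No separation axiom is assumed, so a compact set need not be measurable. The set `A` is
measurable and therefore splits the measure of an arbitrary set, which is enough. -/
theorem regular_restrict_of_isFiniteMeasure [IsFiniteMeasure μ] [μ.Regular] {A : Set X}
    (hA : MeasurableSet A) : (μ.restrict A).Regular where
  lt_top_of_isCompact _ _ := measure_lt_top _ _
  outerRegular := by
    intro B hB r hr
    have hr' : μ B < μ (B \ A) + r := by
      rw [← measure_inter_add_sdiff B hA, add_comm]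
      rw [Measure.restrict_apply hB] at hr
      exact ENNReal.add_lt_add_left (measure_ne_top _ _) hr
    obtain ⟨U, hBU, hU, hμU⟩ := B.exists_isOpen_lt_of_lt _ hr'
    refine ⟨U, hBU, hU, ?_⟩
    rw [Measure.restrict_apply hU.measurableSet]
    rw [← measure_inter_add_sdiff U hA, add_comm] at hμU
    exact lt_of_add_lt_add_left ((add_le_add_left
      (measure_mono (Set.sdiff_subset_sdiff_left hBU)) _).trans_lt hμU)
  innerRegular := by
    intro U hU r hr
    rw [Measure.restrict_apply hU.measurableSet] at hr
    have hr' : μ (U \ A) + r < μ U := by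
      rw [← measure_inter_add_sdiff U hA, add_comm (μ (U ∩ A))]
      exact ENNReal.add_lt_add_left (measure_ne_top _ _) hr
    obtain ⟨K, hKU, hK, hμK⟩ := Measure.Regular.innerRegular hU _ hr'
    refine ⟨K, hKU, hK, ?_⟩
    rw [Measure.restrict_apply' hA]
    rw [← measure_inter_add_sdiff K hA, add_comm (μ (K ∩ A))] at hμK
    exact lt_of_add_lt_add_left (hμK.trans_le (add_le_add_left
      (measure_mono (Set.sdiff_subset_sdiff_left hKU)) _))

end Regular

theorem sum_restrict_eq_restrict_iUnion {X ι : Type*} [MeasurableSpace X] [Fintype ι]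
    {μ : Measure X} {A : ι → Set X} (hA : ∀ i, MeasurableSet (A i))
    (hd : ∀ i j, i ≠ j → μ (A i ∩ A j) = 0) :
    ∑ i, μ.restrict (A i) = μ.restrict (⋃ i, A i) := by
  rw [Measure.restrict_iUnion_ae (fun i j hij => hd i j hij) fun i => (hA i).nullMeasurableSet,
    Measure.sum_fintype]

/-! ### Weak and strong feasibility sets -/

theorem mainTheorem4 {X : Type*} [TopologicalSpace X] [CompactSpace X]
    [MeasurableSpace X] [BorelSpace X]
    (μ : Measure X) [μ.Regular] [NullSingletonClass μ]
    (N J : ℕ) (ζ : X → Fin J → ℝ) (hζ : Continuous ζ)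
    (hζΔ : ∀ x, ζ x ∈ stdSimplex ℝ (Fin J)) :
    strongFeasible μ N ζ = weakFeasible μ N ζ ∧
      strongSubFeasible μ N ζ = weakSubFeasible μ N ζ := by
  have hfin : IsFiniteMeasure μ := ⟨isCompact_univ.measure_lt_top⟩
  have hL2 : ∀ j, MemLp (fun x => ζ x j) 2 μ := fun j =>
    MemLp.of_bound ((continuous_apply j).comp hζ).measurable.aestronglyMeasurable 1
      (.of_forall fun x => by
        rw [Real.norm_of_nonneg ((hζΔ x).1 j), ← (hζΔ x).2]
        exact Finset.single_le_sum (fun k _ => (hζΔ x).1 k) (Finset.mem_univ j))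
  have hat := fun s (hs : MeasurableSet s) => exists_measurable_subset_pos_lt (μ := μ) hs
  refine ⟨Set.ext fun M => and_congr_right fun _ => ⟨?_, ?_⟩,
    Set.ext fun M => and_congr_right fun _ => ⟨?_, ?_⟩⟩
  · rintro ⟨A, ⟨⟨hA, hd⟩, hu⟩, rfl⟩
    refine ⟨fun i => μ.restrict (A i), ⟨fun i => regular_restrict_of_isFiniteMeasure (hA i), ?_⟩,
      rfl⟩
    rw [sum_restrict_eq_restrict_iUnion hA hd]
    exact Measure.restrict_eq_self_of_ae_mem ((ae_iff_measure_eq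
      (MeasurableSet.iUnion hA).nullMeasurableSet).2 hu)
  · rintro ⟨ν, ⟨-, hν⟩, rfl⟩
    obtain ⟨A, hA, hd, hu, hint⟩ := exists_partition_setIntegral_eq hat hL2 hν
    exact ⟨A, ⟨⟨hA, hd⟩, hu⟩, Matrix.ext hint⟩
  · rintro ⟨A, ⟨hA, hd⟩, rfl⟩
    refine ⟨fun i => μ.restrict (A i), ⟨fun i => regular_restrict_of_isFiniteMeasure (hA i), ?_⟩,
      rfl⟩
    rw [sum_restrict_eq_restrict_iUnion hA hd]
    exact Measure.restrict_le_self
  · rintro ⟨ν, ⟨-, hν⟩, rfl⟩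
    have : IsFiniteMeasure (∑ i, ν i) := isFiniteMeasure_of_le μ hν
    -- the unused mass is added as one more measure, whose set is then discarded
    obtain ⟨A, hA, hd, -, hint⟩ := exists_partition_setIntegral_eq hat hL2
      (ν := (Fin.cons (μ - ∑ i, ν i) ν : Fin (N + 1) → Measure X))
      (by simpa [Fin.sum_univ_succ] using Measure.sub_add_cancel_of_le hν)
    exact ⟨fun i => A i.succ, ⟨fun i => hA _, fun i j hij => hd _ _
      ((Fin.succ_injective N).ne hij)⟩, Matrix.ext fun i j => hint i.succ j⟩
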